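/- Let $k$ be a field and let $A$ be an associative unital $k$-algebra. Let $S$ be a finite set of elements of $A$. Assume that $A$ is a one-way algebra with respect to $S$, that is: 1. $A$ is finite-dimensional over $k$, and $S$ is a complete set of orthogonal idempotents: $e^2=e$ for all $e\in S$, $ef=0$ for $e\neq f$ in $S$, and $\sum_{e\in S}e=1$; 2. for $e\neq f$ in $S$, if $eAf\neq 0$ then $fAe=0$; 3. $\dim_k(eAe)=1$ for all $e\in S$; 4. $S$ has more than one element, and the graph with vertex set $S$ and an edge between distinct $e,f$ whenever $eAf\neq 0$ or $fAe\neq 0$ is connected. Let $DA=\mathrm{Hom}_k(A,k)$ be the dual bimodule, with $(af)(x)=f(xa)$ and $(fa)(x)=f(ax)$, and let $TA=A\oplus DA$ be the trivial extension of $A$, with product $(a+f)(b+g)=ab+ag+fb$. For a $k$-algebra $\Lambda$ write $H^1(\Lambda,\Lambda)$ for the first Hochschild cohomology space of $\Lambda$ over $k$ with coefficients in $\Lambda$. Then there is an isomorphism of $k$-vector spaces $$H^1(TA,TA)\;\cong\; k\oplus H^1(A,A).$$ -/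

import Mathlib

/-! ### Hochschild cohomology -/

section Hochschild

variable {k A X : Type*} [Field k] [Ring A] [Algebra k A]
  [AddCommGroup X] [Module k X] [Module A X] [Module Aᵐᵒᵖ X]
  [IsScalarTower k A X] [IsScalarTower k Aᵐᵒᵖ X]

variable (k A X) in
/-- Hochschild `n`-cochains of `A` with coefficients in the `A`-bimodule `X` (the right action of
`A` is encoded as an action of `Aᵐᵒᵖ`): `k`-linear maps `A ⊗ₖ ⋯ ⊗ₖ A → X` with `n` factors, that
is, `k`-multilinear maps of `n` arguments. -/
abbrev HochschildCochain (n : ℕ) : Type _ :=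
  MultilinearMap k (fun _ : Fin n => A) X

namespace HochschildCochain

variable {n : ℕ}

/-- `(x₀, …, xₙ) ↦ x₀ f(x₁, …, xₙ)`. -/
def leftFace (f : HochschildCochain k A X n) : HochschildCochain k A X (n + 1) :=
  MultilinearMap.mk' (fun x => x 0 • f (Fin.tail x))
    (by
      intro x m a b
      refine Fin.cases ?_ (fun j => ?_) m
      · simp [Fin.tail_update_zero, add_smul]
      · simp [Fin.tail_update_succ, smul_add, Function.update_of_ne (Fin.succ_ne_zero j).symm])
    (by
      intro x m c a
      refine Fin.cases ?_ (fun j => ?_) m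
      · simp [Fin.tail_update_zero]
      · simp [Fin.tail_update_succ, Function.update_of_ne (Fin.succ_ne_zero j).symm,
          smul_comm c])

/-- `(x₀, …, xₙ) ↦ f(x₀, …, xₙ₋₁) xₙ`. -/
def rightFace (f : HochschildCochain k A X n) : HochschildCochain k A X (n + 1) :=
  MultilinearMap.mk' (fun x => MulOpposite.op (x (Fin.last n)) • f (Fin.init x))
    (by
      intro x m a b
      refine Fin.lastCases ?_ (fun j => ?_) m
      · simp [Fin.init_update_last, add_smul]
      · simp [Fin.init_update_castSucc, smul_add,
          Function.update_of_ne (Fin.castSucc_lt_last j).ne'])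
    (by
      intro x m c a
      refine Fin.lastCases ?_ (fun j => ?_) m
      · simp [Fin.init_update_last]
      · simp [Fin.init_update_castSucc, Function.update_of_ne (Fin.castSucc_lt_last j).ne',
          smul_comm c])

variable (k) in
lemma contractNth_update (i : Fin n) (x : Fin (n + 1) → A) (m : Fin (n + 1)) :
    ∃ (q : Fin n) (L : A →ₗ[k] A), ∀ a,
      Fin.contractNth i.castSucc (· * ·) (Function.update x m a) =
        Function.update (Fin.contractNth i.castSucc (· * ·) x) q (L a) := by
  rcases lt_trichotomy m i.castSucc with h | h | h
  · have hm : (m : ℕ) < i := h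
    refine ⟨⟨m, by omega⟩, LinearMap.id, fun a => ?_⟩
    funext j
    simp only [Fin.contractNth, Function.update_apply, Fin.ext_iff, Fin.val_castSucc, Fin.val_succ,
      LinearMap.id_apply]
    split_ifs <;> first | rfl | omega
  · refine ⟨i, LinearMap.mulRight k (x i.succ), fun a => ?_⟩
    subst h
    funext j
    simp only [Fin.contractNth, Function.update_apply, Fin.ext_iff, Fin.val_castSucc, Fin.val_succ,
      LinearMap.mulRight_apply]
    by_cases hj : (j : ℕ) = i
    · obtain rfl := Fin.ext hj
      simp
    · split_ifs <;> first | rfl | omega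
  · have hm : (i : ℕ) < m := h
    by_cases hm' : (m : ℕ) = i + 1
    · have : m = i.succ := Fin.ext hm'
      subst this
      refine ⟨i, LinearMap.mulLeft k (x i.castSucc), fun a => ?_⟩
      funext j
      simp only [Fin.contractNth, Function.update_apply, Fin.ext_iff, Fin.val_castSucc,
        Fin.val_succ, LinearMap.mulLeft_apply]
      by_cases hj : (j : ℕ) = i
      · obtain rfl := Fin.ext hj
        simp
      · split_ifs <;> first | rfl | omega
    · refine ⟨⟨m - 1, by omega⟩, LinearMap.id, fun a => ?_⟩
      funext j
      simp only [Fin.contractNth, Function.update_apply, Fin.ext_iff, Fin.val_castSucc,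
        Fin.val_succ, LinearMap.id_apply]
      split_ifs <;> first | rfl | omega

/-- `(x₀, …, xₙ) ↦ f(x₀, …, xᵢ xᵢ₊₁, …, xₙ)`. -/
def innerFace (i : Fin n) (f : HochschildCochain k A X n) : HochschildCochain k A X (n + 1) :=
  MultilinearMap.mk' (fun x => f (Fin.contractNth i.castSucc (· * ·) x))
    (by
      intro x m a b
      obtain ⟨q, L, h⟩ := contractNth_update k i x m
      simp [h])
    (by
      intro x m c a
      obtain ⟨q, L, h⟩ := contractNth_update k i x m
      simp [h])

variable (k A X) in
/-- The Hochschild differential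
`(d f)(x₀, …, xₙ) = x₀ f(x₁, …, xₙ) + ∑ᵢ (-1)ⁱ⁺¹ f(x₀, …, xᵢ xᵢ₊₁, …, xₙ)
  + (-1)ⁿ⁺¹ f(x₀, …, xₙ₋₁) xₙ`, where `i` runs from `0` to `n - 1`. -/
def d (n : ℕ) : HochschildCochain k A X n →ₗ[k] HochschildCochain k A X (n + 1) where
  toFun f := leftFace f + ∑ i : Fin n, (-1 : k) ^ ((i : ℕ) + 1) • innerFace i f
    + (-1 : k) ^ (n + 1) • rightFace f
  map_add' f g := by
    ext x
    simp [leftFace, rightFace, innerFace, Finset.sum_add_distrib]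
    abel
  map_smul' c f := by
    ext x
    simp [leftFace, rightFace, innerFace, Finset.smul_sum, smul_comm c]

variable (k A X) in
/-- Hochschild `n`-coboundaries. -/
def coboundaries : (n : ℕ) → Submodule k (HochschildCochain k A X n)
  | 0 => ⊥
  | n + 1 => LinearMap.range (d k A X n)

variable (k A X) in
/-- Hochschild `n`-cocycles. -/
def cocycles (n : ℕ) : Submodule k (HochschildCochain k A X n) :=
  LinearMap.ker (d k A X n)

end HochschildCochain

variable (k A X) in
/-- The Hochschild cohomology space `Hⁿ(A, X)`: cocycles modulo coboundaries. -/
abbrev HochschildCohomology (n : ℕ) : Type _ :=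
  HochschildCochain.cocycles k A X n ⧸
    (HochschildCochain.coboundaries k A X n).submoduleOf (HochschildCochain.cocycles k A X n)

end Hochschild

/-! ### Trivial extensions -/

section TrivialExtension

/-- The dual bimodule `DA = Homₖ(A, k)`. -/
def DualBimodule (k A : Type*) [Field k] [Ring A] [Algebra k A] : Type _ :=
  Module.Dual k A

namespace DualBimodule

variable {k A : Type*} [Field k] [Ring A] [Algebra k A]

instance : AddCommGroup (DualBimodule k A) := inferInstanceAs (AddCommGroup (Module.Dual k A))

instance : Module k (DualBimodule k A) := inferInstanceAs (Module k (Module.Dual k A))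

instance : FunLike (DualBimodule k A) A k := inferInstanceAs (FunLike (Module.Dual k A) A k)

/-- The left action `(a • f)(x) = f(x a)`. -/
instance : Module A (DualBimodule k A) where
  smul a f := LinearMap.comp (M₃ := k) f (LinearMap.mulRight k a)
  one_smul f := LinearMap.ext fun x => congrArg f (mul_one x)
  mul_smul a b f := LinearMap.ext fun x => congrArg f (mul_assoc x a b).symm
  smul_zero _ := LinearMap.ext fun _ => rfl
  smul_add _ _ _ := LinearMap.ext fun _ => rfl
  add_smul a b f := LinearMap.ext fun x =>
    (congrArg f (mul_add x a b)).trans (LinearMap.map_add (M₃ := k) f _ _)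
  zero_smul f := LinearMap.ext fun x =>
    (congrArg f (mul_zero x)).trans (LinearMap.map_zero (M₃ := k) f)

/-- The right action `(f • a)(x) = f(a x)`. -/
instance : Module Aᵐᵒᵖ (DualBimodule k A) where
  smul a f := LinearMap.comp (M₃ := k) f (LinearMap.mulLeft k a.unop)
  one_smul f := LinearMap.ext fun x => congrArg f (one_mul x)
  mul_smul a b f := LinearMap.ext fun x => congrArg f (mul_assoc b.unop a.unop x)
  smul_zero _ := LinearMap.ext fun _ => rfl
  smul_add _ _ _ := LinearMap.ext fun _ => rfl
  add_smul a b f := LinearMap.ext fun x =>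
    (congrArg f (add_mul a.unop b.unop x)).trans (LinearMap.map_add (M₃ := k) f _ _)
  zero_smul f := LinearMap.ext fun x =>
    (congrArg f (zero_mul x)).trans (LinearMap.map_zero (M₃ := k) f)

@[simp] lemma smul_apply (a : A) (f : DualBimodule k A) (x : A) : (a • f) x = f (x * a) := rfl

@[simp] lemma op_smul_apply (a : A) (f : DualBimodule k A) (x : A) :
    (MulOpposite.op a • f) x = f (a * x) := rfl

instance : SMulCommClass A Aᵐᵒᵖ (DualBimodule k A) where
  smul_comm a b f := LinearMap.ext fun x => congrArg f (mul_assoc b.unop x a).symm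

instance : IsScalarTower k A (DualBimodule k A) where
  smul_assoc c a f := LinearMap.ext fun x =>
    (congrArg f (mul_smul_comm c x a)).trans (LinearMap.map_smul (M₂ := k) f c _)

instance : IsScalarTower k Aᵐᵒᵖ (DualBimodule k A) where
  smul_assoc c a f := LinearMap.ext fun x =>
    (congrArg f (smul_mul_assoc c a.unop x)).trans (LinearMap.map_smul (M₂ := k) f c _)

end DualBimodule

/-- The trivial extension `TA = A ⊕ DA`, with product
`(a + f)(b + g) = a b + (a g + f b)`. -/
abbrev TrivialExtension (k A : Type*) [Field k] [Ring A] [Algebra k A] : Type _ :=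
  TrivSqZeroExt A (DualBimodule k A)

end TrivialExtension

/-! ### One-way algebras -/

section OneWay

variable (k : Type*) {A : Type*} [Field k] [Ring A] [Algebra k A]

/-- The subspace `e A f` of `A`. -/
def peirceComponent (e f : A) : Submodule k A :=
  LinearMap.range (LinearMap.mulLeft k e ∘ₗ LinearMap.mulRight k f)

/-- The graph with vertex set `S` and an edge between distinct `e` and `f` whenever `e A f` or
`f A e` is not zero. -/
def peirceGraph (S : Finset A) : SimpleGraph S :=
  SimpleGraph.fromRel fun e f => peirceComponent k (e : A) (f : A) ≠ ⊥

/-- `A` is a one-way algebra with respect to the set `S` of idempotents. -/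
structure IsOneWayAlgebra (S : Finset A) : Prop where
  finiteDimensional : FiniteDimensional k A
  idempotents : CompleteOrthogonalIdempotents (Subtype.val : S → A)
  oneWay : ∀ e ∈ S, ∀ f ∈ S, e ≠ f → peirceComponent k e f ≠ ⊥ → peirceComponent k f e = ⊥
  corner : ∀ e ∈ S, Module.finrank k (peirceComponent k e e) = 1
  one_lt_card : 1 < S.card
  connected : (peirceGraph k S).Connected

end OneWay

/-! In degree one, cohomology is derivations modulo inner derivations. A derivation `D` of `TA` has
four components: a derivation `α : A → A`, a derivation `A → DA`, a bimodule map `φ : DA → A`, and a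
map `ψ : DA → DA` obeying a Leibniz rule twisted by `α`.

The one-way condition disposes of two of them: derivations `A → DA` are inner
(`dual_derivation_inner`) and `φ = 0` (`dual_to_self_eq_zero`). Given `α`, the map `ψ` is determined
up to a bimodule endomorphism of `DA`. Such endomorphisms are scalars (`dual_endomorphism_eq_smul`),
because they come from the centre of `A`, which is `k` by connectedness. Conversely, every `α`
extends by `ψ = c - αᵗ` for any scalar `c`.

Hence the class of `D` is recorded by the class of `α` and one scalar. To read off the scalar, fix
`e ∈ S`, let `ε` be the form with `e x e = ε(x) e`, and take `ψ(ε)(e)`: this vanishes on inner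
derivations and equals `c` on the extension above. -/

/-! ### First Hochschild cohomology as derivations modulo inner derivations -/

section FirstCohomology

open MulOpposite

variable (k A X : Type*) [Field k] [Ring A] [Algebra k A]
  [AddCommGroup X] [Module k X] [Module A X] [Module Aᵐᵒᵖ X]
  [IsScalarTower k A X] [IsScalarTower k Aᵐᵒᵖ X]

/-- The `k`-linear derivations from `A` to the bimodule `X`. -/
def bimoduleDerivations : Submodule k (A →ₗ[k] X) where
  carrier := {D | ∀ a b, D (a * b) = a • D b + op b • D a}
  add_mem' {D E} hD hE a b := by
    simp only [LinearMap.add_apply, hD a b, hE a b, smul_add]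
    abel
  zero_mem' a b := by simp
  smul_mem' c D hD a b := by
    simp only [LinearMap.smul_apply, hD a b, smul_add, smul_comm c]

/-- The inner derivations from `A` to the bimodule `X`. -/
def innerBimoduleDerivations : Submodule k (A →ₗ[k] X) where
  carrier := {D | ∃ x, ∀ a, D a = a • x - op a • x}
  add_mem' := by
    rintro D E ⟨x, hx⟩ ⟨y, hy⟩
    refine ⟨x + y, fun a => ?_⟩
    simp only [LinearMap.add_apply, hx, hy, smul_add]
    abel
  zero_mem' := ⟨0, by simp⟩
  smul_mem' := by
    rintro c D ⟨x, hx⟩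
    refine ⟨c • x, fun a => ?_⟩
    simp only [LinearMap.smul_apply, hx, smul_sub, smul_comm c]

variable {k A X}

lemma mem_bimoduleDerivations {D : A →ₗ[k] X} :
    D ∈ bimoduleDerivations k A X ↔ ∀ a b, D (a * b) = a • D b + op b • D a := Iff.rfl

lemma mem_innerBimoduleDerivations {D : A →ₗ[k] X} :
    D ∈ innerBimoduleDerivations k A X ↔ ∃ x, ∀ a, D a = a • x - op a • x := Iff.rfl

lemma innerBimoduleDerivations_le [SMulCommClass A Aᵐᵒᵖ X] :
    innerBimoduleDerivations k A X ≤ bimoduleDerivations k A X := by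
  rintro D ⟨x, hx⟩ a b
  rw [hx, hx, hx, smul_sub, smul_sub, mul_smul, op_mul, mul_smul, smul_comm a (op b) x]
  abel

variable (k A X) in
/-- Derivations modulo inner derivations. -/
abbrev OuterDerivations : Type _ :=
  bimoduleDerivations k A X ⧸
    (innerBimoduleDerivations k A X).submoduleOf (bimoduleDerivations k A X)

namespace OuterDerivations

variable (k A X) in
/-- The class of a derivation modulo inner derivations. -/
def mk : bimoduleDerivations k A X →ₗ[k] OuterDerivations k A X := Submodule.mkQ _

lemma mk_surjective : Function.Surjective (mk k A X) := Submodule.mkQ_surjective _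

lemma mk_eq_zero_iff {D : bimoduleDerivations k A X} :
    mk k A X D = 0 ↔ D.1 ∈ innerBimoduleDerivations k A X :=
  Submodule.Quotient.mk_eq_zero _

end OuterDerivations

lemma HochschildCochain.ofSubsingleton_mem_cocycles_iff (D : A →ₗ[k] X) :
    MultilinearMap.ofSubsingletonₗ k k A X (0 : Fin 1) D ∈ cocycles k A X 1 ↔
      D ∈ bimoduleDerivations k A X := by
  rw [cocycles, LinearMap.mem_ker, mem_bimoduleDerivations]
  have key : ∀ x : Fin 2 → A,
      d k A X 1 (MultilinearMap.ofSubsingletonₗ k k A X (0 : Fin 1) D) x =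
        x 0 • D (x 1) - D (x 0 * x 1) + op (x 1) • D (x 0) := by
    intro x
    simp [d, leftFace, rightFace, innerFace, Fin.tail, Fin.init, Fin.contractNth, sub_eq_add_neg]
  constructor
  · intro h a b
    have := key ![a, b]
    rw [h] at this
    simp only [_root_.zero_apply, Matrix.cons_val_zero, Matrix.cons_val_one] at this
    rw [← sub_eq_zero, ← neg_eq_zero, this]
    abel
  · intro h
    ext x
    rw [key, h]
    simp

lemma HochschildCochain.ofSubsingleton_mem_coboundaries_iff (D : A →ₗ[k] X) :
    MultilinearMap.ofSubsingletonₗ k k A X (0 : Fin 1) D ∈ coboundaries k A X 1 ↔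
      D ∈ innerBimoduleDerivations k A X := by
  have key : ∀ (m : HochschildCochain k A X 0) (x : Fin 1 → A),
      d k A X 0 m x = x 0 • m ![] - op (x 0) • m ![] := by
    intro m x
    simp [d, leftFace, rightFace, sub_eq_add_neg, Matrix.empty_eq]
  rw [coboundaries, LinearMap.mem_range, mem_innerBimoduleDerivations]
  constructor
  · rintro ⟨m, hm⟩
    refine ⟨m ![], fun a => ?_⟩
    have := key m ![a]
    rw [hm] at this
    simpa using this
  · rintro ⟨x, hx⟩
    refine ⟨MultilinearMap.constOfIsEmpty k _ x, ?_⟩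
    ext y
    rw [key]
    simp [hx]

variable (k A X) in
/-- The first Hochschild cohomology is the space of derivations modulo inner ones. -/
noncomputable def firstCohomologyEquiv :
    HochschildCohomology k A X 1 ≃ₗ[k] OuterDerivations k A X := by
  let e := MultilinearMap.ofSubsingletonₗ k k A X (0 : Fin 1)
  have hmap : (bimoduleDerivations k A X).map (e : _ →ₗ[k] _) =
      HochschildCochain.cocycles k A X 1 := by
    ext f
    obtain ⟨D, rfl⟩ := e.surjective f
    rw [HochschildCochain.ofSubsingleton_mem_cocycles_iff]
    exact (Submodule.mem_map_equiv _ (e := e)).trans (by rw [e.symm_apply_apply])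
  let e' : bimoduleDerivations k A X ≃ₗ[k] HochschildCochain.cocycles k A X 1 :=
    e.ofSubmodules _ _ hmap
  refine (Submodule.Quotient.equiv _ _ e' ?_).symm
  ext f
  obtain ⟨D, rfl⟩ := e'.surjective f
  refine (Submodule.mem_map_equiv _ (e := e')).trans ?_
  rw [e'.symm_apply_apply, Submodule.submoduleOf, Submodule.submoduleOf, Submodule.mem_comap,
    Submodule.mem_comap]
  exact (HochschildCochain.ofSubsingleton_mem_coboundaries_iff D.1).symm

end FirstCohomology

/-! ### The dual bimodule -/

namespace DualBimodule

variable {k A : Type*} [Field k] [Ring A] [Algebra k A]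

instance : LinearMapClass (DualBimodule k A) k A k :=
  inferInstanceAs (LinearMapClass (Module.Dual k A) k A k)

@[ext] lemma ext {f g : DualBimodule k A} (h : ∀ x, f x = g x) : f = g := LinearMap.ext h

@[simp] lemma add_apply (f g : DualBimodule k A) (x : A) : (f + g) x = f x + g x := rfl

@[simp] lemma sub_apply (f g : DualBimodule k A) (x : A) : (f - g) x = f x - g x := rfl

@[simp] lemma zero_apply (x : A) : (0 : DualBimodule k A) x = 0 := rfl

@[simp] lemma scalar_smul_apply (c : k) (f : DualBimodule k A) (x : A) :
    (c • f) x = c * f x := rfl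

/-- Precomposition with a linear endomorphism. -/
def transpose (δ : A →ₗ[k] A) : DualBimodule k A →ₗ[k] DualBimodule k A := δ.dualMap

@[simp] lemma transpose_apply (δ : A →ₗ[k] A) (f : DualBimodule k A) (x : A) :
    transpose δ f x = f (δ x) := rfl

lemma exists_apply_eq_one {x : A} (hx : x ≠ 0) : ∃ f : DualBimodule k A, f x = 1 := by
  obtain ⟨f, hf⟩ := not_forall.1 (mt (Module.forall_dual_apply_eq_zero_iff k x).1 hx)
  exact ⟨(f x)⁻¹ • f, inv_mul_cancel₀ hf⟩

lemma eq_of_forall_apply_eq {x y : A} (h : ∀ f : DualBimodule k A, f x = f y) : x = y := by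
  by_contra hxy
  obtain ⟨f, hf⟩ := exists_apply_eq_one (k := k) (sub_ne_zero.2 hxy)
  rw [map_sub, h f, sub_self] at hf
  exact zero_ne_one hf

/-- A linear form on the dual of a finite-dimensional algebra is an evaluation. -/
lemma exists_eq_eval [FiniteDimensional k A] (L : DualBimodule k A →ₗ[k] k) :
    ∃ z : A, ∀ f, L f = f z := by
  obtain ⟨z, hz⟩ := (Module.evalEquiv k A).surjective L
  exact ⟨z, fun f => (LinearMap.congr_fun hz f).symm⟩

end DualBimodule

/-! ### One-way algebras -/

namespace IsOneWayAlgebra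

open MulOpposite

variable {k A : Type*} [Field k] [Ring A] [Algebra k A] {S : Finset A}

lemma peirceComponent_eq_bot_iff {e f : A} :
    peirceComponent k e f = ⊥ ↔ ∀ x, e * x * f = 0 := by
  rw [peirceComponent, LinearMap.range_eq_bot, LinearMap.ext_iff]
  simp [mul_assoc]

lemma peirceComponent_ne_bot_iff {e f : A} :
    peirceComponent k e f ≠ ⊥ ↔ ∃ x, e * x * f ≠ 0 := by
  simp [peirceComponent_eq_bot_iff]

lemma mul_self (hS : IsOneWayAlgebra k S) {e : A} (he : e ∈ S) : e * e = e :=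
  hS.idempotents.idem ⟨e, he⟩

lemma mul_eq_zero (hS : IsOneWayAlgebra k S) {e f : A} (he : e ∈ S) (hf : f ∈ S) (h : e ≠ f) :
    e * f = 0 :=
  hS.idempotents.ortho (i := ⟨e, he⟩) (j := ⟨f, hf⟩) (by simpa using h)

lemma sum_eq_one (hS : IsOneWayAlgebra k S) : ∑ e : S, (e : A) = 1 :=
  hS.idempotents.complete

lemma peirce_eq_zero (hS : IsOneWayAlgebra k S) {e f : A} (he : e ∈ S) (hf : f ∈ S) (h : e ≠ f)
    {x : A} (hx : e * x * f ≠ 0) (y : A) : f * y * e = 0 :=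
  peirceComponent_eq_bot_iff.1
    (hS.oneWay e he f hf h (peirceComponent_ne_bot_iff.2 ⟨x, hx⟩)) y

lemma sum_peirce (hS : IsOneWayAlgebra k S) {X : Type*} [AddCommGroup X] [Module A X]
    [Module Aᵐᵒᵖ X] (x : X) :
    x = ∑ e : S, ∑ f : S, (e : A) • op (f : A) • x := by
  have h : ∑ f : S, op (f : A) = 1 := by
    rw [← op_one, ← hS.sum_eq_one]
    simp
  simp_rw [← Finset.smul_sum, ← Finset.sum_smul, h, hS.sum_eq_one, one_smul]

/-- Stated for any bimodule, since it is applied both to `A` and to `DA`. -/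
lemma eq_zero_of_peirce (hS : IsOneWayAlgebra k S) {X : Type*} [AddCommGroup X] [Module A X]
    [Module Aᵐᵒᵖ X] {x : X} (h : ∀ e ∈ S, ∀ f ∈ S, e • op f • x = 0) : x = 0 := by
  rw [hS.sum_peirce x]
  exact Finset.sum_eq_zero fun e _ => Finset.sum_eq_zero fun f _ => h e e.2 f f.2

lemma ne_zero (hS : IsOneWayAlgebra k S) {e : A} (he : e ∈ S) : e ≠ 0 := by
  rintro rfl
  have h := hS.corner 0 he
  rw [peirceComponent_eq_bot_iff.2 (by simp), finrank_bot] at h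
  exact zero_ne_one h

lemma exists_smul_eq (hS : IsOneWayAlgebra k S) {e : A} (he : e ∈ S) (x : A) :
    ∃ c : k, e * x * e = c • e := by
  obtain ⟨c, hc⟩ := (finrank_eq_one_iff_of_nonzero'
    (⟨e, ⟨e, by simp [hS.mul_self he]⟩⟩ : peirceComponent k e e)
    (fun h => hS.ne_zero he (congrArg Subtype.val h))).1 (hS.corner e he) ⟨e * x * e, ⟨x, by simp [mul_assoc]⟩⟩
  exact ⟨c, (congrArg Subtype.val hc).symm⟩

/-- The form is the coordinate on the line `eAe = k e`. It spans `e (DA) e` and later serves to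
detect the scalar summand. -/
lemma exists_coeff (hS : IsOneWayAlgebra k S) {e : A} (he : e ∈ S) :
    ∃ f : DualBimodule k A, f e = 1 ∧ ∀ x, e * x * e = f x • e := by
  obtain ⟨g, hg⟩ := DualBimodule.exists_apply_eq_one (k := k) (hS.ne_zero he)
  -- This is `x ↦ g(e x e)`, with `g` normalised by `g e = 1`.
  refine ⟨e • op e • g, by simp [hS.mul_self he, hg], fun x => ?_⟩
  obtain ⟨c, hc⟩ := hS.exists_smul_eq he x
  rw [DualBimodule.smul_apply, DualBimodule.op_smul_apply, ← mul_assoc, hc, map_smul, hg,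
    smul_eq_mul, mul_one]

lemma adj_iff {e f : S} : (peirceGraph k S).Adj e f ↔
    (e : A) ≠ f ∧ ((∃ x, (e : A) * x * f ≠ 0) ∨ ∃ x, (f : A) * x * e ≠ 0) := by
  rw [peirceGraph, SimpleGraph.fromRel_adj, peirceComponent_ne_bot_iff,
    peirceComponent_ne_bot_iff, Ne, Subtype.ext_iff]

/-- A connected graph with more than one vertex has no isolated vertex. This excludes `A = k`, where
`DA ≅ A` as bimodules and `dual_to_self_eq_zero` fails. -/
lemma exists_neighbor (hS : IsOneWayAlgebra k S) {e : A} (he : e ∈ S) :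
    ∃ f ∈ S, e ≠ f ∧ ((∃ x, e * x * f ≠ 0) ∨ ∃ x, f * x * e ≠ 0) := by
  have : Nontrivial S := by
    rw [← Fintype.one_lt_card_iff_nontrivial, Fintype.card_coe]
    exact hS.one_lt_card
  obtain ⟨f, hf⟩ := hS.connected.preconnected.exists_adj_of_nontrivial ⟨e, he⟩
  exact ⟨f, f.2, adj_iff.1 hf⟩

lemma exists_mem (hS : IsOneWayAlgebra k S) : ∃ e, e ∈ S :=
  Finset.card_pos.1 (zero_lt_one.trans hS.one_lt_card)

/-- The centre of a one-way algebra consists of the scalars. -/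
lemma exists_eq_algebraMap (hS : IsOneWayAlgebra k S) {z : A} (hz : ∀ x, z * x = x * z) :
    ∃ c : k, z = c • (1 : A) := by
  have hze : ∀ e : S, ∃ c : k, z * e = c • (e : A) := fun e => by
    obtain ⟨c, hc⟩ := hS.exists_smul_eq e.2 z
    exact ⟨c, by rw [← hc, ← hz, mul_assoc, hS.mul_self e.2]⟩
  choose c hc using hze
  -- On a nonzero `e x f`, the element `z` acts from the left by `c e` and from the right by `c f`;
  -- centrality equates them.
  have step : ∀ (e f : S) (x : A), (e : A) * x * f ≠ 0 → c e = c f := by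
    intro e f x hx
    have h1 : z * (e * x * f) = c e • (e * x * f) := by
      rw [← mul_assoc, ← mul_assoc, hc, smul_mul_assoc, smul_mul_assoc]
    have h2 : z * (e * x * f) = c f • (e * x * f) := by
      rw [hz, mul_assoc, ← hz, hc, mul_smul_comm]
    exact smul_left_injective k hx (h1.symm.trans h2)
  have adj : ∀ e f : S, (peirceGraph k S).Adj e f → c e = c f := by
    intro e f h
    obtain ⟨-, ⟨x, hx⟩ | ⟨x, hx⟩⟩ := adj_iff.1 h
    · exact step e f x hx
    · exact (step f e x hx).symm
  have walk : ∀ e f : S, c e = c f := by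
    intro e f
    obtain ⟨w⟩ := hS.connected.preconnected e f
    induction w with
    | nil => rfl
    | cons h _ ih => exact (adj _ _ h).trans ih
  obtain ⟨e₀, he₀⟩ := hS.exists_mem
  refine ⟨c ⟨e₀, he₀⟩, ?_⟩
  rw [← mul_one z, ← hS.sum_eq_one, Finset.mul_sum, Finset.smul_sum]
  exact Finset.sum_congr rfl fun e _ => by rw [hc, walk e]

/-- Up to an inner derivation, a derivation vanishes on `S`. -/
lemma exists_eq_on_idempotents (hS : IsOneWayAlgebra k S) {X : Type*} [AddCommGroup X]
    [Module k X] [Module A X] [Module Aᵐᵒᵖ X] [SMulCommClass A Aᵐᵒᵖ X] [IsScalarTower k A X]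
    [IsScalarTower k Aᵐᵒᵖ X] {D : A →ₗ[k] X} (hD : D ∈ bimoduleDerivations k A X) :
    ∃ x : X, ∀ e ∈ S, D e = e • x - op e • x := by
  classical
  -- The witness is `-∑ D(f) f`. Multiplying `D(ef) = e D(f) + D(e) f` on the right by `f` and
  -- summing over `f` gives `e ∑ D(f) f = D(e) e - D(e)`.
  refine ⟨-∑ e : S, op (e : A) • D e, fun e he => ?_⟩
  have h1 : e • ∑ f : S, op (f : A) • D f = op e • D e - D e := by
    have hop : ∀ (f : A), f ∈ S → ∀ x : X, op f • op f • x = op f • x := fun f hf x => by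
      rw [← mul_smul, ← op_mul, hS.mul_self hf]
    have hterm : ∀ f : S, e • op (f : A) • D f =
        (if f = ⟨e, he⟩ then op e • D e else 0) - op (f : A) • D e := by
      intro f
      have hef := congrArg (fun x => op (f : A) • x) (hD e f)
      simp only [smul_add, hop f f.2] at hef
      rw [smul_comm, eq_sub_iff_add_eq, ← hef]
      split_ifs with h
      · subst h
        rw [hS.mul_self he]
      · rw [hS.mul_eq_zero he f.2 fun h' => h (Subtype.ext h'.symm), map_zero, smul_zero]
    rw [Finset.smul_sum, Finset.sum_congr rfl fun f _ => hterm f, Finset.sum_sub_distrib,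
      Finset.sum_ite_eq', if_pos (Finset.mem_univ _), ← Finset.sum_smul]
    congr 1
    rw [← Finset.op_sum, hS.sum_eq_one, op_one, one_smul]
  have h2 : op e • ∑ f : S, op (f : A) • D f = op e • D e := by
    rw [Finset.smul_sum, Finset.sum_eq_single ⟨e, he⟩]
    · rw [← mul_smul, ← op_mul, hS.mul_self he]
    · intro f _ hf
      rw [← mul_smul, ← op_mul, hS.mul_eq_zero f.2 he fun h => hf (Subtype.ext h), op_zero,
        zero_smul]
    · exact fun h => (h (Finset.mem_univ _)).elim
  rw [smul_neg, smul_neg, h1, h2]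
  abel

end IsOneWayAlgebra

/-! ### Derivations and bimodule maps involving the dual bimodule -/

namespace IsOneWayAlgebra

open MulOpposite

variable {k A : Type*} [Field k] [Ring A] [Algebra k A] {S : Finset A}

/-- Every derivation of a one-way algebra with values in the dual bimodule is inner. -/
lemma dual_derivation_inner (hS : IsOneWayAlgebra k S) {D : A →ₗ[k] DualBimodule k A}
    (hD : D ∈ bimoduleDerivations k A (DualBimodule k A)) :
    ∃ f : DualBimodule k A, ∀ a, D a = a • f - op a • f := by
  obtain ⟨f, hf⟩ := hS.exists_eq_on_idempotents hD
  refine ⟨f, fun a => ?_⟩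
  have hinner : ∀ a b : A, (a * b) • f - op (a * b) • f =
      a • (b • f - op b • f) + op b • (a • f - op a • f) := by
    intro a b
    rw [smul_sub, smul_sub, mul_smul, op_mul, mul_smul, smul_comm a (op b) f]
    abel
  -- Both derivations agree at `e` and `e'`, so in the Leibniz expansion at `e a e'` only the `(e,
  -- e')` components of the values at `a` survive cancellation.
  have key : ∀ e ∈ S, ∀ e' ∈ S,
      D (e * a * e') = (e * a * e') • f - op (e * a * e') • f →
      e • op e' • (D a - (a • f - op a • f)) = 0 := by
    intro e he e' he' h
    rw [hD, hD, hinner, hinner, hf e he, hf e' he', add_right_inj, smul_add, smul_add,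
      add_left_inj] at h
    rw [smul_sub, smul_sub, sub_eq_zero, smul_comm e, h, smul_comm e]
  refine sub_eq_zero.1 (hS.eq_zero_of_peirce fun e he e' he' => ?_)
  by_cases hee : e = e'
  · subst hee
    obtain ⟨c, hc⟩ := hS.exists_smul_eq he a
    refine key e he e he ?_
    rw [hc, map_smul, hf e he, smul_sub, smul_assoc, op_smul, smul_assoc]
  · by_cases h : e * a * e' = 0
    · exact key e he e' he' (by simp [h])
    -- The component `e (DA) e'` is dual to `e' A e`, which is zero because `e A e'` is not.
    · ext x
      rw [DualBimodule.smul_apply, DualBimodule.op_smul_apply, ← mul_assoc,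
        hS.peirce_eq_zero he he' hee h, map_zero, DualBimodule.zero_apply]

/-- There is no nonzero bimodule map from the dual bimodule of a one-way algebra to the algebra. -/
lemma dual_to_self_eq_zero (hS : IsOneWayAlgebra k S) {φ : DualBimodule k A →ₗ[k] A}
    (hl : ∀ (a : A) f, φ (a • f) = a * φ f) (hr : ∀ (a : A) f, φ (op a • f) = φ f * a)
    (f : DualBimodule k A) : φ f = 0 := by
  refine hS.eq_zero_of_peirce fun e he e' he' => ?_
  rw [op_smul_eq_mul, smul_eq_mul, ← hr, ← hl]
  by_cases hee : e = e'
  · subst hee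
    obtain ⟨ε, hεe, hε⟩ := hS.exists_coeff he
    have hf : e • op e • f = f e • ε := by
      ext x
      rw [DualBimodule.smul_apply, DualBimodule.op_smul_apply, ← mul_assoc, hε, map_smul,
        DualBimodule.scalar_smul_apply, smul_eq_mul, mul_comm]
    suffices φ ε = 0 by rw [hf, map_smul, this, smul_zero]
    -- A neighbour factors `ε` through an off-diagonal component of `DA`, whose image under `φ` lies
    -- in a zero component of `A`.
    obtain ⟨e', he', hne, ⟨x, hx⟩ | ⟨x, hx⟩⟩ := hS.exists_neighbor he
    · obtain ⟨ξ, hξ⟩ := DualBimodule.exists_apply_eq_one (k := k) hx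
      have h : ε = (e * x) • e' • op e • ξ := by
        ext y
        simp only [DualBimodule.smul_apply, DualBimodule.op_smul_apply]
        rw [show e * (y * (e * x) * e') = (e * y * e) * (x * e') by simp only [mul_assoc], hε,
          smul_mul_assoc, ← mul_assoc, map_smul, hξ, smul_eq_mul, mul_one]
      rw [h, hl, hl, hr, ← mul_assoc e', hS.peirce_eq_zero he he' hne hx, mul_zero]
    · obtain ⟨ξ, hξ⟩ := DualBimodule.exists_apply_eq_one (k := k) hx
      have h : ε = op (x * e) • e • op e' • ξ := by
        ext y
        simp only [DualBimodule.smul_apply, DualBimodule.op_smul_apply]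
        rw [show e' * (x * e * y * e) = (e' * x) * (e * y * e) by simp only [mul_assoc], hε,
          mul_smul_comm, map_smul, hξ, smul_eq_mul, mul_one]
      rw [h, hr, hl, hr, ← mul_assoc e, hS.peirce_eq_zero he' he hne.symm hx, zero_mul]
  -- Either `e' A e ≠ 0` and the target `e A e'` vanishes, or `e' A e = 0` and its dual `e (DA) e'`
  -- vanishes.
  · by_cases h : ∃ x, e' * x * e ≠ 0
    · obtain ⟨x, hx⟩ := h
      rw [hl, hr, ← mul_assoc, hS.peirce_eq_zero he' he (Ne.symm hee) hx]
    · have : e • op e' • f = 0 := by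
        ext x
        push Not at h
        rw [DualBimodule.smul_apply, DualBimodule.op_smul_apply, ← mul_assoc, h, map_zero,
          DualBimodule.zero_apply]
      rw [this, map_zero]

/-- The bimodule endomorphisms of the dual bimodule of a one-way algebra are the scalars. -/
lemma dual_endomorphism_eq_smul (hS : IsOneWayAlgebra k S)
    {ψ : DualBimodule k A →ₗ[k] DualBimodule k A}
    (hl : ∀ (a : A) f, ψ (a • f) = a • ψ f) (hr : ∀ (a : A) f, ψ (op a • f) = op a • ψ f) :
    ∃ c : k, ∀ f, ψ f = c • f := by
  have := hS.finiteDimensional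
  -- The form `f ↦ ψ(f)(1)` is evaluation at some `z`. Left and right linearity give `ψ(f)(x) =
  -- f(zx)` and `ψ(f)(x) = f(xz)`, so `z` is central.
  obtain ⟨z, hz⟩ := DualBimodule.exists_eq_eval
    ({ toFun := fun f => ψ f 1
       map_add' := fun f g => by simp
       map_smul' := fun c f => by simp } : DualBimodule k A →ₗ[k] k)
  replace hz : ∀ f, ψ f 1 = f z := hz
  have h1 : ∀ f x, ψ f x = f (z * x) := fun f x => by
    have := hz (x • f)
    rwa [hl, DualBimodule.smul_apply, DualBimodule.smul_apply, one_mul] at this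
  have h2 : ∀ f x, ψ f x = f (x * z) := fun f x => by
    have := hz (op x • f)
    rwa [hr, DualBimodule.op_smul_apply, DualBimodule.op_smul_apply, mul_one] at this
  obtain ⟨c, rfl⟩ := hS.exists_eq_algebraMap fun x =>
    DualBimodule.eq_of_forall_apply_eq (k := k) fun f => (h1 f x).symm.trans (h2 f x)
  refine ⟨c, fun f => ?_⟩
  ext x
  rw [h1, smul_mul_assoc, one_mul, map_smul, DualBimodule.scalar_smul_apply, smul_eq_mul]

end IsOneWayAlgebra

/-! ### Derivations of the trivial extension -/

namespace TrivialExtension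

open MulOpposite TrivSqZeroExt

variable {k A : Type*} [Field k] [Ring A] [Algebra k A]

/-- The component `A → A` of an endomorphism of `TA`. -/
def baseComponent : (TrivialExtension k A →ₗ[k] TrivialExtension k A) →ₗ[k] A →ₗ[k] A where
  toFun D :=
    { toFun := fun a => (D (inl a)).fst
      map_add' := fun a b => by simp
      map_smul' := fun c a => by simp }
  map_add' _ _ := rfl
  map_smul' _ _ := rfl

/-- The component `A → DA` of an endomorphism of `TA`. -/
def baseDualComponent (D : TrivialExtension k A →ₗ[k] TrivialExtension k A) :
    A →ₗ[k] DualBimodule k A where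
  toFun a := (D (inl a)).snd
  map_add' a b := by simp
  map_smul' c a := by simp

/-- The component `DA → A` of an endomorphism of `TA`. -/
def dualBaseComponent (D : TrivialExtension k A →ₗ[k] TrivialExtension k A) :
    DualBimodule k A →ₗ[k] A where
  toFun f := (D (inr f)).fst
  map_add' f g := by simp
  map_smul' c f := by simp

/-- The component `DA → DA` of an endomorphism of `TA`. -/
def dualComponent (D : TrivialExtension k A →ₗ[k] TrivialExtension k A) :
    DualBimodule k A →ₗ[k] DualBimodule k A where
  toFun f := (D (inr f)).snd
  map_add' f g := by simp
  map_smul' c f := by simp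

@[simp] lemma baseComponent_apply (D : TrivialExtension k A →ₗ[k] TrivialExtension k A) (a : A) :
    baseComponent D a = (D (inl a)).fst := rfl

@[simp] lemma baseDualComponent_apply (D : TrivialExtension k A →ₗ[k] TrivialExtension k A)
    (a : A) : baseDualComponent D a = (D (inl a)).snd := rfl

@[simp] lemma dualBaseComponent_apply (D : TrivialExtension k A →ₗ[k] TrivialExtension k A)
    (f : DualBimodule k A) : dualBaseComponent D f = (D (inr f)).fst := rfl

@[simp] lemma dualComponent_apply (D : TrivialExtension k A →ₗ[k] TrivialExtension k A)
    (f : DualBimodule k A) : dualComponent D f = (D (inr f)).snd := rfl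

variable {D : TrivialExtension k A →ₗ[k] TrivialExtension k A}

lemma derivation_mul
    (hD : D ∈ bimoduleDerivations k (TrivialExtension k A) (TrivialExtension k A))
    (x y : TrivialExtension k A) : D (x * y) = x * D y + D x * y := hD x y

lemma baseComponent_mem
    (hD : D ∈ bimoduleDerivations k (TrivialExtension k A) (TrivialExtension k A)) :
    baseComponent D ∈ bimoduleDerivations k A A := by
  intro a b
  simp [inl_mul, derivation_mul hD]

lemma baseDualComponent_mem
    (hD : D ∈ bimoduleDerivations k (TrivialExtension k A) (TrivialExtension k A)) :
    baseDualComponent D ∈ bimoduleDerivations k A (DualBimodule k A) := by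
  intro a b
  simp [inl_mul, derivation_mul hD]

lemma derivation_smul_inr
    (hD : D ∈ bimoduleDerivations k (TrivialExtension k A) (TrivialExtension k A))
    (a : A) (f : DualBimodule k A) :
    D (inr (a • f)) = inl a * D (inr f) + D (inl a) * inr f := by
  rw [← inl_mul_inr, derivation_mul hD]

lemma derivation_op_smul_inr
    (hD : D ∈ bimoduleDerivations k (TrivialExtension k A) (TrivialExtension k A))
    (a : A) (f : DualBimodule k A) :
    D (inr (op a • f)) = inr f * D (inl a) + D (inr f) * inl a := by
  rw [← inr_mul_inl, derivation_mul hD]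

/-- The other Leibniz term `D(a) f` lies in the ideal `DA`, so it has no `A`-part. -/
lemma dualBaseComponent_smul
    (hD : D ∈ bimoduleDerivations k (TrivialExtension k A) (TrivialExtension k A))
    (a : A) (f : DualBimodule k A) :
    dualBaseComponent D (a • f) = a * dualBaseComponent D f := by
  simp [derivation_smul_inr hD, -inr_smul]

lemma dualBaseComponent_op_smul
    (hD : D ∈ bimoduleDerivations k (TrivialExtension k A) (TrivialExtension k A))
    (a : A) (f : DualBimodule k A) :
    dualBaseComponent D (op a • f) = dualBaseComponent D f * a := by
  simp [derivation_op_smul_inr hD, -inr_smul]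

/-- The twist by the base component disappears once that component is made zero, leaving a genuine
bimodule map. -/
lemma dualComponent_smul
    (hD : D ∈ bimoduleDerivations k (TrivialExtension k A) (TrivialExtension k A))
    (a : A) (f : DualBimodule k A) :
    dualComponent D (a • f) = a • dualComponent D f + baseComponent D a • f := by
  simp [derivation_smul_inr hD, -inr_smul]

lemma dualComponent_op_smul
    (hD : D ∈ bimoduleDerivations k (TrivialExtension k A) (TrivialExtension k A))
    (a : A) (f : DualBimodule k A) :
    dualComponent D (op a • f) = op a • dualComponent D f + op (baseComponent D a) • f := by
  simp [derivation_op_smul_inr hD, -inr_smul, add_comm]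

lemma baseComponent_mem_inner
    (hD : D ∈ innerBimoduleDerivations k (TrivialExtension k A) (TrivialExtension k A)) :
    baseComponent D ∈ innerBimoduleDerivations k A A := by
  obtain ⟨t, ht⟩ := hD
  exact ⟨t.fst, fun a => by simp [ht]⟩

lemma dualComponent_of_inner {t : TrivialExtension k A} (ht : ∀ y, D y = y • t - op y • t)
    (f : DualBimodule k A) : dualComponent D f = op t.fst • f - t.fst • f := by
  simp [ht]

/-- The endomorphism `a + f ↦ δ a + (c f - f ∘ δ)` of `TA`. -/
def extendDerivation (c : k) (δ : A →ₗ[k] A) :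
    TrivialExtension k A →ₗ[k] TrivialExtension k A where
  toFun x := inl (δ x.fst) + inr (c • x.snd - DualBimodule.transpose δ x.snd)
  map_add' x y := by ext <;> simp; ring
  map_smul' b x := by ext <;> simp; ring

lemma extendDerivation_apply (c : k) (δ : A →ₗ[k] A) (x : TrivialExtension k A) :
    extendDerivation c δ x =
      inl (δ x.fst) + inr (c • x.snd - DualBimodule.transpose δ x.snd) := rfl

/-- The `c`-part is `c` times the derivation of the grading with `A` in degree 0 and `DA` in degree
1; the rest is the action of `δ` on `A` and its contragredient on `DA`. -/
lemma extendDerivation_mem (c : k) {δ : A →ₗ[k] A} (hδ : δ ∈ bimoduleDerivations k A A) :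
    extendDerivation c δ ∈
      bimoduleDerivations k (TrivialExtension k A) (TrivialExtension k A) := by
  intro x y
  rw [mem_bimoduleDerivations] at hδ
  ext z
  · simp [extendDerivation_apply, hδ]
  · simp [extendDerivation_apply, hδ]
    ring

/-- A derivation of `TA` with inner component `A → A` and with component `DA → DA` vanishing at a
vertex is inner. -/
lemma mem_inner_of_components {S : Finset A} (hS : IsOneWayAlgebra k S)
    (hD : D ∈ bimoduleDerivations k (TrivialExtension k A) (TrivialExtension k A))
    (hbase : baseComponent D ∈ innerBimoduleDerivations k A A) {e : A} {ε : DualBimodule k A}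
    (hεe : ε e = 1) (hcomm : ∀ x, ε (x * e) = ε (e * x)) (hdual : dualComponent D ε e = 0) :
    D ∈ innerBimoduleDerivations k (TrivialExtension k A) (TrivialExtension k A) := by
  obtain ⟨x, hx⟩ := hbase
  let I : TrivialExtension k A →ₗ[k] TrivialExtension k A :=
    LinearMap.mulRight k (inl x) - LinearMap.mulLeft k (inl x)
  have hI : ∀ y, I y = y • inl x - op y • inl x := fun y => rfl
  have hE : D - I ∈ bimoduleDerivations k (TrivialExtension k A) (TrivialExtension k A) :=
    Submodule.sub_mem _ hD (innerBimoduleDerivations_le ⟨inl x, hI⟩)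
  have hE0 : baseComponent (D - I) = 0 := by
    ext a
    have := hx a
    simp only [baseComponent_apply] at this
    simp [hI, this]
  obtain ⟨f, hf⟩ := hS.dual_derivation_inner (baseDualComponent_mem hE)
  have hφ := hS.dual_to_self_eq_zero (dualBaseComponent_smul hE) (dualBaseComponent_op_smul hE)
  obtain ⟨c, hc⟩ := hS.dual_endomorphism_eq_smul (ψ := dualComponent (D - I))
    (fun a g => by rw [dualComponent_smul hE, hE0, LinearMap.zero_apply, zero_smul, add_zero])
    (fun a g => by
      rw [dualComponent_op_smul hE, hE0, LinearMap.zero_apply, op_zero, zero_smul, add_zero])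
  -- Evaluate at `ε` and `e`: `D` contributes zero by `hdual`, and `I` contributes `ε(x e) - ε(e x)
  -- = 0`.
  have hc0 : c = 0 := by
    have h := DFunLike.congr_fun (hc ε) e
    have hsub : dualComponent (D - I) ε = dualComponent D ε - dualComponent I ε := by simp
    rw [hsub, dualComponent_of_inner hI, DualBimodule.sub_apply, hdual] at h
    simpa [hcomm, hεe] using h.symm
  subst hc0
  refine ⟨inl x + inr f, fun y => ?_⟩
  have hsplit : (D - I) y = y • inr f - op y • inr f := by
    rw [← inl_fst_add_inr_snd_eq y, map_add]
    ext1
    · have h1 : ((D - I) (inl y.fst)).fst = 0 := LinearMap.congr_fun hE0 y.fst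
      have h2 : ((D - I) (inr y.snd)).fst = 0 := hφ y.snd
      rw [fst_add, h1, h2]
      simp
    · have h1 : ((D - I) (inl y.fst)).snd = y.fst • f - op y.fst • f := hf y.fst
      have h2 : ((D - I) (inr y.snd)).snd = (0 : k) • y.snd := hc y.snd
      rw [snd_add, h1, h2]
      simp
  rw [LinearMap.sub_apply, hI, sub_eq_iff_eq_add] at hsplit
  rw [hsplit, smul_add, smul_add]
  abel

/-! ### The invariants that give the isomorphism -/

/-- The map sending a derivation of `TA` to its value at a dual basis vector and the class of its
component `A → A`. -/
noncomputable def derivationInvariants (ε : DualBimodule k A) (e : A) :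
    bimoduleDerivations k (TrivialExtension k A) (TrivialExtension k A) →ₗ[k]
      k × OuterDerivations k A A :=
  LinearMap.prod
    { toFun := fun D => dualComponent D.1 ε e
      map_add' := fun D E => by simp
      map_smul' := fun c D => by simp }
    (OuterDerivations.mk k A A ∘ₗ baseComponent.restrict fun _ hD => baseComponent_mem hD)

lemma derivationInvariants_apply (ε : DualBimodule k A) (e : A)
    (D : bimoduleDerivations k (TrivialExtension k A) (TrivialExtension k A)) :
    derivationInvariants ε e D =
      (dualComponent D.1 ε e, OuterDerivations.mk k A A ⟨baseComponent D.1, baseComponent_mem D.2⟩) :=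
  rfl

lemma ker_derivationInvariants {S : Finset A} (hS : IsOneWayAlgebra k S) {e : A}
    {ε : DualBimodule k A} (hεe : ε e = 1) (hcomm : ∀ x, ε (x * e) = ε (e * x)) :
    LinearMap.ker (derivationInvariants ε e) =
      (innerBimoduleDerivations k (TrivialExtension k A) (TrivialExtension k A)).submoduleOf
        (bimoduleDerivations k (TrivialExtension k A) (TrivialExtension k A)) := by
  ext D
  rw [LinearMap.mem_ker, derivationInvariants_apply, Prod.mk_eq_zero,
    OuterDerivations.mk_eq_zero_iff]
  constructor
  · rintro ⟨h1, h2⟩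
    exact mem_inner_of_components hS D.2 h2 hεe hcomm h1
  · intro h
    refine ⟨?_, baseComponent_mem_inner h⟩
    obtain ⟨t, ht⟩ := h
    rw [dualComponent_of_inner (D := D.1) ht]
    simp [hcomm]

lemma derivationInvariants_surjective {e : A} (he : e * e = e) {ε : DualBimodule k A}
    (hεe : ε e = 1) (hε : ∀ x, e * x * e = ε x • e) :
    Function.Surjective (derivationInvariants (k := k) ε e) := by
  rintro ⟨c, q⟩
  obtain ⟨⟨δ, hδ⟩, rfl⟩ := OuterDerivations.mk_surjective q
  refine ⟨⟨extendDerivation c δ, extendDerivation_mem c hδ⟩, ?_⟩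
  rw [derivationInvariants_apply]
  -- Applying `δ` to `e = e e` and multiplying by `e` on both sides gives `e δ(e) e = 2 e δ(e) e`,
  -- so `e δ(e) e = 0`. The first invariant of the extension, `c - ε(δ e)`, is therefore `c`.
  have hδe : ε (δ e) = 0 := by
    have h := congrArg (fun x => e * x * e) (hδ e e)
    have h' := congrArg ε (hε (δ e))
    simp only [he, smul_eq_mul, op_smul_eq_mul, mul_add, add_mul] at h
    simp only [← mul_assoc, he] at h
    simp only [mul_assoc, he] at h
    rw [← mul_assoc, right_eq_add] at h
    rw [h, map_zero, map_smul, hεe, smul_eq_mul, mul_one] at h'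
    exact h'.symm
  refine Prod.ext ?_ (congrArg (OuterDerivations.mk k A A) (Subtype.ext ?_))
  · simp [extendDerivation_apply, hεe, hδe]
  · ext a
    simp [extendDerivation_apply]

end TrivialExtension

theorem theorem4p9 (k A : Type*) [Field k] [Ring A] [Algebra k A] (S : Finset A)
    (hS : IsOneWayAlgebra k S) :
    Nonempty
      (HochschildCohomology k (TrivialExtension k A) (TrivialExtension k A) 1 ≃ₗ[k]
        k × HochschildCohomology k A A 1) := by
  obtain ⟨e, he⟩ := hS.exists_mem
  obtain ⟨ε, hεe, hε⟩ := hS.exists_coeff he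
  have hee := hS.mul_self he
  -- Both values are the coefficient of `e` in `e x e`.
  have hcomm : ∀ x, ε (x * e) = ε (e * x) := fun x => by
    refine smul_left_injective k (hS.ne_zero he) ?_
    change ε (x * e) • e = ε (e * x) • e
    rw [← hε, ← hε, ← mul_assoc, ← mul_assoc, hee, mul_assoc (e * x), hee]
  exact ⟨firstCohomologyEquiv k _ _ ≪≫ₗ
    Submodule.quotEquivOfEq _ _ (TrivialExtension.ker_derivationInvariants hS hεe hcomm).symm ≪≫ₗ
    LinearMap.quotKerEquivOfSurjective _
      (TrivialExtension.derivationInvariants_surjective hee hεe hε) ≪≫ₗ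
    LinearEquiv.prodCongr (LinearEquiv.refl k k) (firstCohomologyEquiv k A A).symm⟩
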